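/- For integers $p,q$ let $K(p,q)$ be the double twist knot or link, given by its standard diagram: a vertical column of $|p|$ half twists inside a disk, whose two ends at the top are joined to each other, and whose two ends at the bottom are joined to each other, by the two strands of a second column of $|q|$ half twists outside the disk. The half twists have the signs of $p$ and $q$, where a half twist is positive if it is a positive crossing when its two strands are oriented in the same direction along the column. The Kauffman bracket $\langle D\rangle\in\mathbb Z[A,A^{-1}]$ of a link diagram $D$ is normalized by $\langle\text{unknot}\rangle=1$ and $\langle D\sqcup\bigcirc\rangle=(-A^2-A^{-2})\langle D\rangle$, and at a positive crossing the smoothing that respects the orientation has weight $A^{-1}$ and the other one has weight $A$ (correspondingly with $A$ and $A^{-1}$ exchanged at a negative crossing). The Jones polynomial of an oriented link with diagram $D$ and writhe $w$ is obtained from $(-A^{-3})^{-w}\langle D\rangle$ by the substitution $A^4=t$. The span of a nonzero Laurent polynomial in $t$ (possibly with fractional exponents) is understood as its highest degree minus its lowest degree plus $1$. Let $p,q>1$ be integers. Then the lowest degree term of $\langle K(p,q)\rangle$ is $-A^{-p-q}$, and the highest degree term of $\langle K(p,q)\rangle$ is $(-1)^{p+q}A^{3(p+q)-4}$. Hence,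 for every orientation of $K(p,q)$, the span of the Jones polynomial of $K(p,q)$ is $p+q$. -/

import Mathlib

open scoped LaurentPolynomial

/-- An (unoriented) link diagram, given by its planar diagram code.
`Crossing` is the set of double points and `Arc` the set of arcs into which the double points cut
the diagram; a component without double points is a single arc (a free circle).
`strand c 0, strand c 1, strand c 2, strand c 3` are the arcs met when going counterclockwise
around the crossing `c`, where `strand c 0` and `strand c 2` form the strand passing *under*, and
`strand c 1` and `strand c 3` the strand passing *over*. -/
structure LinkDiagram where
  Crossing : Type
  Arc : Type
  [fintypeCrossing : Fintype Crossing]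
  [decEqCrossing : DecidableEq Crossing]
  [finiteArc : Finite Arc]
  [nonemptyArc : Nonempty Arc]
  strand : Crossing → Fin 4 → Arc
  /-- An arc has two ends at crossings, unless it is a free circle. -/
  two_ends : ∀ a : Arc, Nat.card {e : Crossing × Fin 4 // strand e.1 e.2 = a} = 0 ∨
    Nat.card {e : Crossing × Fin 4 // strand e.1 e.2 = a} = 2

namespace LinkDiagram

attribute [instance] fintypeCrossing decEqCrossing finiteArc nonemptyArc

/-! ### The Kauffman bracket -/

/-- A state `s` smooths every crossing in one of the two ways.
With `s c = true` the crossing `c` is replaced by two arcs, one joining ends `0` and `3`, the other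
joining ends `1` and `2`; with `s c = false` ends `0, 1` and ends `2, 3` are joined. -/
def Joined (D : LinkDiagram) (s : D.Crossing → Bool) (a b : D.Arc) : Prop :=
  ∃ c, if s c = true
    then (a = D.strand c 0 ∧ b = D.strand c 3) ∨ (a = D.strand c 1 ∧ b = D.strand c 2)
    else (a = D.strand c 0 ∧ b = D.strand c 1) ∨ (a = D.strand c 2 ∧ b = D.strand c 3)

/-- The number of circles obtained by smoothing the diagram according to the state `s`: the number
of classes of arcs for the equivalence relation generated by the joins. -/
noncomputable def loops (D : LinkDiagram) (s : D.Crossing → Bool) : ℕ :=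
  Nat.card (Quot (D.Joined s))

/-- The Kauffman bracket as a Laurent polynomial in `A` (`LaurentPolynomial.T n` is `A ^ n`), by the
state sum `⟨D⟩ = ∑ₛ A ^ (#true - #false) * (-A² - A⁻²) ^ (loops - 1)`.
Equivalently: `⟨unknot⟩ = 1`, `⟨D ⊔ circle⟩ = (-A² - A⁻²) ⟨D⟩`, and at a crossing
`⟨D⟩ = A ⟨D_true⟩ + A⁻¹ ⟨D_false⟩`. At a positive crossing of an oriented diagram the smoothing that
respects the orientation is the `false` one, with weight `A⁻¹`; this is the convention for which
the Jones polynomial is obtained by the substitution `t = A⁴`. -/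
noncomputable def bracket (D : LinkDiagram) : ℤ[T;T⁻¹] :=
  ∑ s : D.Crossing → Bool,
    (∏ c, if s c = true then LaurentPolynomial.T 1 else LaurentPolynomial.T (-1)) *
      (-LaurentPolynomial.T 2 - LaurentPolynomial.T (-2)) ^ (D.loops s - 1)

/-! ### The Jones polynomial -/

/-- An orientation of a link diagram: `incoming c i` says whether the end `i` of the crossing `c` is
directed towards `c`. Each strand runs straight through a crossing, and an arc that leaves a
crossing at one of its ends arrives at the other end. -/
structure Orientation (D : LinkDiagram) where
  incoming : D.Crossing → Fin 4 → Bool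
  through : ∀ c i, incoming c (i + 2) = !incoming c i
  along : ∀ c i c' i', (c, i) ≠ (c', i') → D.strand c i = D.strand c' i' →
    incoming c i ≠ incoming c' i'

/-- The sign of a crossing: `+1` if the overstrand has to be turned counterclockwise to get the
direction of the understrand, as happens when the understrand runs from `0` to `2` and the overstrand
from `3` to `1` (or both run backwards). -/
def Orientation.sign {D : LinkDiagram} (o : D.Orientation) (c : D.Crossing) : ℤ :=
  if o.incoming c 0 = o.incoming c 3 then 1 else -1

/-- The writhe of an oriented diagram. -/
def Orientation.writhe {D : LinkDiagram} (o : D.Orientation) : ℤ :=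
  ∑ c, o.sign c

/-- The normalized bracket `(-A⁻³) ^ (-w) ⟨D⟩ = (-1) ^ w A ^ (3w) ⟨D⟩`, where `w` is the writhe. -/
noncomputable def normalizedBracket (D : LinkDiagram) (o : D.Orientation) : ℤ[T;T⁻¹] :=
  LaurentPolynomial.C (o.writhe.negOnePow : ℤ) * LaurentPolynomial.T (3 * o.writhe) * D.bracket

/-- The Jones polynomial of the oriented link with diagram `D`, by the substitution `A⁴ = t` in the
normalized bracket: a Laurent polynomial in `t` with rational exponents. -/
noncomputable def jones (D : LinkDiagram) (o : D.Orientation) : AddMonoidAlgebra ℤ ℚ :=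
  AddMonoidAlgebra.mapDomain (fun n : ℤ => (n : ℚ) / 4) (D.normalizedBracket o)

/-! ### Double twist knots -/

/-- The crossing in a column of half twists lying between level `k` and level `k + 1`, where the left
and right strands of the column at level `j` (counted downwards) are the arcs `L j` and `R j`.
The ends are `R (k + 1)` (south-east), `R k` (north-east), `L k` (north-west) and `L (k + 1)`
(south-west), in counterclockwise order. The over strand runs from south-west to north-east if the
half twist is positive, so that the crossing is positive if both strands are directed downwards;
it runs from south-east to north-west if the half twist is negative. -/
def halfTwist {α : Type} (positive : Bool) (L R : ℕ → α) (k : ℕ) : Fin 4 → α :=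
  if positive then ![R (k + 1), R k, L k, L (k + 1)] else ![L (k + 1), R (k + 1), R k, L k]

/-- The number of arcs of the double twist diagram with `m` and `n` crossings; without crossings it is
one free circle. -/
def numArcs (m n : ℕ) : ℕ := max 1 (2 * (m + n))

instance (m n : ℕ) : NeZero (numArcs m n) := ⟨by unfold numArcs; omega⟩

/-- Arcs at the crossings of a double twist diagram whose two columns have `m` half twists of sign
`pos` and `n` half twists of sign `pos'`.
The first column lies inside a disk. Its four ends are `L 0, L m, R m, R 0`, in counterclockwise
order. The second column lies outside the disk (turned by a half turn of the sphere); its ends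
`L' 0, R' 0, R' n, L' n` are glued to `L 0, L m, R m, R 0`, respectively. So the strands of the
second column run from top to top and from bottom to bottom of the first column. Numbering
the arcs cyclically along the closed chain formed by `L`, `R'`, `R` (reversed) and `L'` (reversed),
one has
`L k = k`, `R' k = m + k`, `R k = 2 m + n - k`, `L' k = 2 m + 2 n - k` modulo `2 (m + n)`. -/
def doubleTwistStrand (m n : ℕ) (pos pos' : Bool) :
    Fin m ⊕ Fin n → Fin 4 → ZMod (numArcs m n)
  | .inl k => halfTwist pos (fun j => (j : ZMod (numArcs m n)))
      (fun j => 2 * m + n - j) k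
  | .inr k => halfTwist pos' (fun j => (2 * m + 2 * n - j : ZMod (numArcs m n)))
      (fun j => m + j) k

theorem sum_halfTwist {α : Type} [DecidableEq α] (b : Bool) (L R : ℕ → α) (k : ℕ) (a : α) :
    (∑ i, if halfTwist b L R k i = a then 1 else 0 : ℕ) =
      (if L k = a then 1 else 0) + (if L (k + 1) = a then 1 else 0) +
      ((if R (k + 1) = a then 1 else 0) + (if R k = a then 1 else 0)) := by
  rw [Fin.sum_univ_four]
  cases b
  · change (if L (k + 1) = a then 1 else 0) + (if R (k + 1) = a then 1 else 0) +
      (if R k = a then 1 else 0) + (if L k = a then 1 else 0) = _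
    ring
  · change (if R (k + 1) = a then 1 else 0) + (if R k = a then 1 else 0) +
      (if L k = a then 1 else 0) + (if L (k + 1) = a then 1 else 0) = _
    ring

theorem card_ends {C α : Type} [Fintype C] [DecidableEq α] (f : C → Fin 4 → α) (a : α) :
    Nat.card {e : C × Fin 4 // f e.1 e.2 = a} = ∑ c, ∑ i, if f c i = a then 1 else 0 := by
  rw [Nat.card_eq_fintype_card, Fintype.card_subtype, Finset.card_filter, Fintype.sum_prod_type]

theorem doubleTwist_two_ends (m n : ℕ) (pos pos' : Bool) (a : ZMod (numArcs m n))
    (h : 0 < m + n) :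
    Nat.card {e : (Fin m ⊕ Fin n) × Fin 4 // doubleTwistStrand m n pos pos' e.1 e.2 = a} = 2 := by
  classical
  have hN : numArcs m n = m + n + m + n := by unfold numArcs; omega
  have key : ∀ g : ZMod (numArcs m n) → ℕ,
      ∑ x : ZMod (numArcs m n), g x = ∑ j ∈ Finset.range (m + n + m + n), g (j : ℕ) := by
    intro g
    rw [← hN]
    refine (Finset.sum_bij (fun j _ => ((j : ℕ) : ZMod (numArcs m n))) (by simp) ?_ ?_
      (by simp)).symm
    · intro x hx y hy hxy
      have := (ZMod.natCast_eq_natCast_iff' x y _).1 hxy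
      rwa [Nat.mod_eq_of_lt (Finset.mem_range.1 hx), Nat.mod_eq_of_lt (Finset.mem_range.1 hy)]
        at this
    · intro y _
      exact ⟨y.val, Finset.mem_range.2 (ZMod.val_lt y), ZMod.natCast_zmod_val y⟩
  have one : ∀ b : ZMod (numArcs m n),
      ∑ x : ZMod (numArcs m n), (if x = b then 1 else 0 : ℕ) = 1 := by simp
  have tot : ∑ x : ZMod (numArcs m n),
      ((if x = a then 1 else 0) + (if x + 1 = a then 1 else 0) : ℕ) = 2 := by
    rw [Finset.sum_add_distrib, one]
    simp only [← eq_sub_iff_add_eq, one]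
  rw [card_ends, Fintype.sum_sum_type]
  change (∑ k : Fin m, ∑ i, if halfTwist pos (fun j => (j : ZMod (numArcs m n)))
      (fun j => 2 * m + n - j) k i = a then 1 else 0) +
    (∑ k : Fin n, ∑ i, if halfTwist pos' (fun j => (2 * m + 2 * n - j : ZMod (numArcs m n)))
      (fun j => m + j) k i = a then 1 else 0) = 2
  simp only [sum_halfTwist]
  rw [← tot, key, Finset.sum_range_add, Finset.sum_range_add, Finset.sum_range_add,
    Fin.sum_univ_eq_sum_range (fun k : ℕ =>
      ((if (k : ZMod (numArcs m n)) = a then 1 else 0) +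
        (if ((k + 1 : ℕ) : ZMod (numArcs m n)) = a then 1 else 0) +
        ((if (2 * m + n - (k + 1 : ℕ) : ZMod (numArcs m n)) = a then 1 else 0) +
        (if (2 * m + n - k : ZMod (numArcs m n)) = a then 1 else 0)) : ℕ)),
    Fin.sum_univ_eq_sum_range (fun k : ℕ =>
      ((if (2 * m + 2 * n - k : ZMod (numArcs m n)) = a then 1 else 0) +
        (if (2 * m + 2 * n - (k + 1 : ℕ) : ZMod (numArcs m n)) = a then 1 else 0) +
        ((if (m + (k + 1 : ℕ) : ZMod (numArcs m n)) = a then 1 else 0) +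
        (if (m + k : ZMod (numArcs m n)) = a then 1 else 0)) : ℕ))]
  rw [Finset.sum_add_distrib (s := Finset.range m), Finset.sum_add_distrib (s := Finset.range n)]
  have e1 : ∑ k ∈ Finset.range m,
      ((if (2 * m + n - (k + 1 : ℕ) : ZMod (numArcs m n)) = a then 1 else 0) +
        (if (2 * m + n - k : ZMod (numArcs m n)) = a then 1 else 0) : ℕ) =
      ∑ k ∈ Finset.range m, ((if ((m + n + k : ℕ) : ZMod (numArcs m n)) = a then 1 else 0) +
        (if ((m + n + k : ℕ) : ZMod (numArcs m n)) + 1 = a then 1 else 0) : ℕ) := by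
    rw [← Finset.sum_range_reflect]
    refine Finset.sum_congr rfl fun k hk => ?_
    have hk := Finset.mem_range.1 hk
    have : ((m - 1 - k : ℕ) : ZMod (numArcs m n)) = m - 1 - k := by
      rw [Nat.sub_sub, Nat.cast_sub (by omega)]; push_cast; ring
    push_cast
    rw [this]
    ring_nf
  have e2 : ∑ k ∈ Finset.range n,
      ((if (2 * m + 2 * n - k : ZMod (numArcs m n)) = a then 1 else 0) +
        (if (2 * m + 2 * n - (k + 1 : ℕ) : ZMod (numArcs m n)) = a then 1 else 0) : ℕ) =
      ∑ k ∈ Finset.range n,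
        ((if ((m + n + m + k : ℕ) : ZMod (numArcs m n)) = a then 1 else 0) +
        (if ((m + n + m + k : ℕ) : ZMod (numArcs m n)) + 1 = a then 1 else 0) : ℕ) := by
    rw [← Finset.sum_range_reflect]
    refine Finset.sum_congr rfl fun k hk => ?_
    have hk := Finset.mem_range.1 hk
    have : ((n - 1 - k : ℕ) : ZMod (numArcs m n)) = n - 1 - k := by
      rw [Nat.sub_sub, Nat.cast_sub (by omega)]; push_cast; ring
    push_cast
    rw [this]
    ring_nf
  rw [e1, e2]
  have e3 : ∑ k ∈ Finset.range n,
      ((if (m + (k + 1 : ℕ) : ZMod (numArcs m n)) = a then 1 else 0) +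
        (if (m + k : ZMod (numArcs m n)) = a then 1 else 0) : ℕ) =
      ∑ k ∈ Finset.range n, ((if ((m + k : ℕ) : ZMod (numArcs m n)) = a then 1 else 0) +
        (if ((m + k : ℕ) : ZMod (numArcs m n)) + 1 = a then 1 else 0) : ℕ) := by
    refine Finset.sum_congr rfl fun k _ => ?_
    push_cast
    ring_nf
  rw [e3]
  push_cast
  ring

/-- The standard diagram of the double twist knot (or link) `K(p,q)`: a column of `|p|` half twists of
the sign of `p` and a column of `|q|` half twists of the sign of `q`, glued as described at
`doubleTwistStrand`. -/
def doubleTwist (p q : ℤ) : LinkDiagram where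
  Crossing := Fin p.natAbs ⊕ Fin q.natAbs
  Arc := ZMod (numArcs p.natAbs q.natAbs)
  strand := doubleTwistStrand p.natAbs q.natAbs (decide (0 < p)) (decide (0 < q))
  two_ends a := by
    rcases Nat.eq_zero_or_pos (p.natAbs + q.natAbs) with h | h
    · left
      have : IsEmpty (Fin p.natAbs ⊕ Fin q.natAbs) := by
        rw [isEmpty_sum]
        constructor <;> constructor <;> intro k <;> have := k.isLt <;> omega
      exact Nat.card_of_isEmpty
    · exact Or.inr (doubleTwist_two_ends _ _ _ _ a h)

end LinkDiagram

/-! ### Extreme terms and span of a Laurent polynomial -/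

section Terms

variable {Γ : Type} [AddMonoid Γ] [LinearOrder Γ]

/-- The lowest degree term of the Laurent polynomial `f` is `c x ^ n`. -/
def IsLowestTerm (f : AddMonoidAlgebra ℤ Γ) (n : Γ) (c : ℤ) : Prop :=
  IsLeast {m | f.coeff m ≠ 0} n ∧ f.coeff n = c

/-- The highest degree term of the Laurent polynomial `f` is `c x ^ n`. -/
def IsHighestTerm (f : AddMonoidAlgebra ℤ Γ) (n : Γ) (c : ℤ) : Prop :=
  IsGreatest {m | f.coeff m ≠ 0} n ∧ f.coeff n = c

end Terms

/-- The span of a nonzero Laurent polynomial `f` is `s`, where the span is understood as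
`(highest degree) - (lowest degree) + 1`. -/
def HasSpan (f : AddMonoidAlgebra ℤ ℚ) (s : ℚ) : Prop :=
  ∃ a b : ℚ, IsLeast {m | f.coeff m ≠ 0} a ∧ IsGreatest {m | f.coeff m ≠ 0} b ∧ s = b - a + 1

/-! For positive half twists a `true` smoothing cuts its column horizontally. If `i` and `j`
crossings of the two columns are cut, the number of circles depends only on `i` and `j`: an uncut
column is two parallel strands, and a cut column is a cap, a cup and a stack of closed circles
between them (`card_quot_two_columns`, `loops_doubleTwist`).

With `d = -A² - A⁻²`, the state sum of `d ^ 2 * d ^ circleExponent i j` therefore splits into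
products over the columns, each a power of `A d + A⁻¹` or of `A⁻¹` (`sum_state_two_columns`). For `u
= -A⁴` one has `A d + A⁻¹ = A⁻¹ u` and `d² u = -(u - 1)²`, so `d²` cancels and the bracket becomes
`A ^ (-m - n)` times `u^m + u^n - 1 - u (1 + ... + u^(m-1)) (1 + ... + u^(n-1))`
(`bracket_doubleTwist`).

This polynomial has constant term `-1` and, for `m, n > 1`, leading term `-u^(m+n-1)`. Distinct
powers of `u` are distinct powers of `A`, so both extreme terms can be read off. An orientation only
multiplies the bracket by a signed monomial, which leaves the span unchanged. -/

/-! ### Colorings of a single smoothed column -/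

/-- The labels `l k`, `r k` of the left and right strands of a column of `m` half twists at level `k`
are constant on the circles and arcs of the smoothing of the column in which the crossings `k` with
`s k = true` are smoothed horizontally and the other ones vertically. -/
def IsColumnColoring {Y : Type*} (m : ℕ) (s : ℕ → Bool) (l r : ℕ → Y) : Prop :=
  ∀ k < m, if s k = true then l k = r k ∧ l (k + 1) = r (k + 1)
    else l k = l (k + 1) ∧ r k = r (k + 1)

namespace IsColumnColoring

variable {Y : Type*} {m : ℕ} {s : ℕ → Bool} {l r : ℕ → Y}

/-- The number of cuts above level `k` is the index of the piece through that level; it changes only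
across a cut. -/
theorem of_factor (φ : ℕ → Y) (hl : ∀ k ≤ m, l k = φ (Nat.count (s · = true) k))
    (hr : ∀ k ≤ m, r k = φ (Nat.count (s · = true) k)) : IsColumnColoring m s l r := by
  intro k hk
  rw [hl k hk.le, hr k hk.le, hl (k + 1) hk, hr (k + 1) hk]
  split_ifs with h <;> simp [Nat.count_succ, h]

theorem of_const (h : Nat.count (s · = true) m = 0) (a b : Y) (hl : ∀ k ≤ m, l k = a)
    (hr : ∀ k ≤ m, r k = b) : IsColumnColoring m s l r := by
  intro k hk
  have hs : ¬ s k = true := fun hs => by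
    have := Nat.count_strict_mono (p := (s · = true)) hs hk
    omega
  rw [hl k hk.le, hr k hk.le, hl (k + 1) hk, hr (k + 1) hk, if_neg hs]
  exact ⟨rfl, rfl⟩

theorem eq_zero (hc : IsColumnColoring m s l r) {k : ℕ} (hk : k ≤ m)
    (h : Nat.count (s · = true) k = 0) : l k = l 0 ∧ r k = r 0 := by
  induction k with
  | zero => exact ⟨rfl, rfl⟩
  | succ k ih =>
    rw [Nat.count_succ] at h
    have hs : ¬ s k = true := fun hs => by simp [hs] at h
    have h' := hc k hk
    rw [if_neg hs] at h'
    obtain ⟨h1, h2⟩ := ih (by omega) (by omega)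
    exact ⟨h'.1.symm.trans h1, h'.2.symm.trans h2⟩

theorem left_eq_right_of_pos (hc : IsColumnColoring m s l r) {k : ℕ} (hk : k ≤ m)
    (h : 0 < Nat.count (s · = true) k) : l k = r k := by
  induction k with
  | zero => simp at h
  | succ k ih =>
    rw [Nat.count_succ] at h
    have h' := hc k hk
    by_cases hs : s k = true
    · rw [if_pos hs] at h'
      exact h'.2
    · rw [if_neg hs] at h'
      rw [if_neg hs] at h
      exact h'.1.symm.trans ((ih (by omega) (by omega)).trans h'.2)

/-- The two labels stay constant down to the first cut, where they must agree. -/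
theorem left_zero_eq_right_zero (hc : IsColumnColoring m s l r)
    (h : 0 < Nat.count (s · = true) m) : l 0 = r 0 := by
  by_contra hne
  have : ∀ k ≤ m, Nat.count (s · = true) k = 0 := by
    intro k hk
    induction k with
    | zero => simp
    | succ k ih =>
      have hk0 := ih (by omega)
      obtain ⟨h1, h2⟩ := hc.eq_zero (by omega : k ≤ m) hk0
      have h' := hc k hk
      by_cases hs : s k = true
      · rw [if_pos hs, h1, h2] at h'
        exact absurd h'.1 hne
      · simp [Nat.count_succ, hk0, hs]
  have := this m le_rfl
  omega

theorem left_eq_right (hc : IsColumnColoring m s l r)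
    (h : 0 < Nat.count (s · = true) m) {k : ℕ} (hk : k ≤ m) : l k = r k := by
  rcases Nat.eq_zero_or_pos (Nat.count (s · = true) k) with h0 | h0
  · obtain ⟨h1, h2⟩ := hc.eq_zero hk h0
    rw [h1, h2, hc.left_zero_eq_right_zero h]
  · exact hc.left_eq_right_of_pos hk h0

theorem left_eq_of_count_eq (hc : IsColumnColoring m s l r) {j k : ℕ} (hjk : j ≤ k) (hk : k ≤ m)
    (h : Nat.count (s · = true) j = Nat.count (s · = true) k) : l j = l k := by
  induction k, hjk using Nat.le_induction with
  | base => rfl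
  | succ k hjk ih =>
    have h1 := Nat.count_monotone (s · = true) hjk
    rw [Nat.count_succ] at h
    have hs : ¬ s k = true := fun hs => by simp [hs] at h; omega
    have h' := hc k hk
    rw [if_neg hs] at h'
    rw [if_neg hs] at h
    exact (ih (by omega) h).trans h'.1

/-- Converse of `of_factor`: once there is a cut, the pieces of the column are exactly the values of
the count. -/
theorem exists_factor (hc : IsColumnColoring m s l r) (h : 0 < Nat.count (s · = true) m) :
    ∃ φ : ℕ → Y, ∀ k ≤ m, l k = φ (Nat.count (s · = true) k) ∧
      r k = φ (Nat.count (s · = true) k) := by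
  classical
  have key : ∀ j ≤ m, ∀ k ≤ m,
      Nat.count (s · = true) j = Nat.count (s · = true) k → l j = l k := by
    intro j hj k hk e
    rcases le_total j k with hjk | hjk
    · exact hc.left_eq_of_count_eq hjk hk e
    · exact (hc.left_eq_of_count_eq hjk hj e.symm).symm
  -- `l 0` is a junk value for indices that no level attains.
  refine ⟨fun x => if hx : ∃ k, k ≤ m ∧ Nat.count (s · = true) k = x then l hx.choose else l 0,
    fun k hk => ?_⟩
  have hx : ∃ k', k' ≤ m ∧ Nat.count (s · = true) k' = Nat.count (s · = true) k := ⟨k, hk, rfl⟩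
  rw [← hc.left_eq_right h hk]
  have : l k = l hx.choose := key _ hk _ hx.choose_spec.1 hx.choose_spec.2.symm
  simp only [dif_pos hx]
  exact ⟨this, this⟩

end IsColumnColoring

/-! ### Counting the circles of two glued columns -/

theorem Nat.exists_count_eq (p : ℕ → Prop) [DecidablePred p] {m x : ℕ} (h : x ≤ Nat.count p m) :
    ∃ k ≤ m, Nat.count p k = x := by
  induction m with
  | zero => exact ⟨0, le_rfl, by simp at h ⊢; omega⟩
  | succ m ih =>
    rcases Nat.lt_or_ge (Nat.count p m) x with hx | hx
    · refine ⟨m + 1, le_rfl, ?_⟩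
      rw [Nat.count_succ] at h ⊢
      split_ifs at h ⊢ <;> omega
    · obtain ⟨k, hk, e⟩ := ih hx
      exact ⟨k, by omega, e⟩

/-- `F` numbers the classes: invariance makes it descend to the quotient, and `G`, recovering a
class from its number, makes it injective there. -/
theorem Nat.card_quot_eq {A : Type} {rel : A → A → Prop} {N : ℕ} (F : A → ℕ)
    (hF : ∀ a b, rel a b → F a = F b) (hlt : ∀ a, F a < N) (hsurj : ∀ x < N, ∃ a, F a = x)
    (G : ℕ → Quot rel) (hG : ∀ a, G (F a) = Quot.mk rel a) : Nat.card (Quot rel) = N := by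
  rw [← Nat.card_fin N]
  refine Nat.card_congr (Equiv.ofBijective
    (Quot.lift (fun a => (⟨F a, hlt a⟩ : Fin N)) fun a b h => by simp [hF a b h]) ⟨?_, ?_⟩)
  · rintro ⟨a⟩ ⟨b⟩ h
    have h' : F a = F b := congrArg Fin.val h
    change Quot.mk rel a = Quot.mk rel b
    rw [← hG, ← hG, h']
  · rintro ⟨x, hx⟩
    obtain ⟨a, rfl⟩ := hsurj x hx
    exact ⟨Quot.mk rel a, rfl⟩

/-- The number of circles, minus one, of a smoothing of a double twist diagram with `i` horizontally
smoothed crossings in one column and `j` in the other one. -/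
def circleExponent (i j : ℕ) : ℕ := if i = 0 then j else if j = 0 then i else i + j - 2

/-- Abstracts from the arc numbering: `lift` builds functions on arcs from labels compatible with
the gluing, and `hrel` says which functions are constant on circles. Each case gives an explicit
numbering of the circles, inverted by the factorizations of the tautological coloring by `Quot.mk`.
-/
theorem card_quot_two_columns {A : Type} {rel : A → A → Prop} {m n : ℕ} {s s' : ℕ → Bool}
    {L R L' R' : ℕ → A}
    (cover : ∀ a, (∃ k ≤ m, a = L k ∨ a = R k) ∨ (∃ k ≤ n, a = L' k ∨ a = R' k))
    (h1 : L' 0 = L 0) (h2 : R' 0 = L m) (h4 : L' n = R 0)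
    (lift : ∀ l r l' r' : ℕ → ℕ, l' 0 = l 0 → r' 0 = l m → r' n = r m → l' n = r 0 →
      ∃ F : A → ℕ, (∀ k ≤ m, F (L k) = l k ∧ F (R k) = r k) ∧
        (∀ k ≤ n, F (L' k) = l' k ∧ F (R' k) = r' k))
    (hrel : ∀ (Y : Type) (F : A → Y), (∀ a b, rel a b → F a = F b) ↔
      IsColumnColoring m s (fun k => F (L k)) (fun k => F (R k)) ∧
      IsColumnColoring n s' (fun k => F (L' k)) (fun k => F (R' k))) :
    Nat.card (Quot rel) =
      circleExponent (Nat.count (s · = true) m) (Nat.count (s' · = true) n) + 1 := by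
  obtain ⟨c1, c2⟩ := (hrel (Quot rel) (Quot.mk rel)).1 fun a b h => Quot.sound h
  have mono := Nat.count_monotone (s · = true)
  have mono' := Nat.count_monotone (s' · = true)
  have e1 : Quot.mk rel (L' 0) = Quot.mk rel (L 0) := by rw [h1]
  have e2 : Quot.mk rel (R' 0) = Quot.mk rel (L m) := by rw [h2]
  have e4 : Quot.mk rel (L' n) = Quot.mk rel (R 0) := by rw [h4]
  set i := Nat.count (s · = true) m with hi
  set j := Nat.count (s' · = true) n with hj
  have z : Nat.count (s · = true) 0 = 0 := Nat.count_zero _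
  have z' : Nat.count (s' · = true) 0 = 0 := Nat.count_zero _
  rcases Nat.eq_zero_or_pos i with i0 | i0 <;> rcases Nat.eq_zero_or_pos j with j0 | j0
  · have k1 : ∀ k ≤ m, Quot.mk rel (L k) = Quot.mk rel (L 0) ∧
        Quot.mk rel (R k) = Quot.mk rel (R 0) := fun k hk =>
      c1.eq_zero hk (by have := mono hk; omega)
    have k2 : ∀ k ≤ n, Quot.mk rel (L' k) = Quot.mk rel (L' 0) ∧
        Quot.mk rel (R' k) = Quot.mk rel (R' 0) := fun k hk =>
      c2.eq_zero hk (by have := mono' hk; omega)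
    have f1 := (k1 m le_rfl).1
    have f2 := (k2 n le_rfl).1
    refine Nat.card_quot_eq (fun _ => 0) (fun _ _ _ => rfl) (fun _ => by omega)
      (fun x hx => ⟨L 0, by simp [circleExponent, i0, j0] at hx; omega⟩)
      (fun _ => Quot.mk rel (L 0)) fun a => ?_
    rcases cover a with ⟨k, hk, rfl | rfl⟩ | ⟨k, hk, rfl | rfl⟩
    · exact (k1 k hk).1.symm
    · rw [(k1 k hk).2, ← e4, f2, e1]
    · rw [(k2 k hk).1, e1]
    · rw [(k2 k hk).2, e2, f1]
  · have k1 : ∀ k ≤ m, Quot.mk rel (L k) = Quot.mk rel (L 0) ∧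
        Quot.mk rel (R k) = Quot.mk rel (R 0) := fun k hk =>
      c1.eq_zero hk (by have := mono hk; omega)
    obtain ⟨φ, hφ⟩ := c2.exists_factor j0
    -- The left strand of the uncut first column closes up piece `0` of the second column, the right
    -- strand piece `j`; this gives `j + 1` circles.
    obtain ⟨F, hF1, hF2⟩ := lift (fun _ => 0) (fun _ => j) (fun k => Nat.count (s' · = true) k)
      (fun k => Nat.count (s' · = true) k) (by simp) (by simp) rfl rfl
    refine Nat.card_quot_eq F ((hrel ℕ F).2 ⟨.of_const (by omega) 0 j (fun k hk => (hF1 k hk).1)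
      (fun k hk => (hF1 k hk).2), .of_factor id (fun k hk => (hF2 k hk).1)
      (fun k hk => (hF2 k hk).2)⟩) (fun a => ?_) (fun x hx => ?_) φ fun a => ?_
    · simp only [circleExponent, i0, if_true]
      rcases cover a with ⟨k, hk, rfl | rfl⟩ | ⟨k, hk, rfl | rfl⟩
      · rw [(hF1 k hk).1]; omega
      · rw [(hF1 k hk).2]; omega
      · rw [(hF2 k hk).1]; have := mono' hk; omega
      · rw [(hF2 k hk).2]; have := mono' hk; omega
    · simp only [circleExponent, i0, if_true] at hx
      obtain ⟨k, hk, e⟩ := Nat.exists_count_eq (s' · = true) (Nat.lt_succ_iff.1 hx)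
      exact ⟨L' k, (hF2 k hk).1.trans e⟩
    · have g0 := (hφ 0 (Nat.zero_le _)).1
      have gn := (hφ n le_rfl).1
      rw [z'] at g0
      rcases cover a with ⟨k, hk, rfl | rfl⟩ | ⟨k, hk, rfl | rfl⟩
      · rw [(hF1 k hk).1, (k1 k hk).1, ← e1, g0]
      · rw [(hF1 k hk).2, (k1 k hk).2, ← e4, gn]
      · rw [(hF2 k hk).1, (hφ k hk).1]
      · rw [(hF2 k hk).2, (hφ k hk).2]
  · have k2 : ∀ k ≤ n, Quot.mk rel (L' k) = Quot.mk rel (L' 0) ∧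
        Quot.mk rel (R' k) = Quot.mk rel (R' 0) := fun k hk =>
      c2.eq_zero hk (by have := mono' hk; omega)
    obtain ⟨φ, hφ⟩ := c1.exists_factor i0
    obtain ⟨F, hF1, hF2⟩ := lift (fun k => Nat.count (s · = true) k)
      (fun k => Nat.count (s · = true) k) (fun _ => 0) (fun _ => i) (by simp) rfl rfl (by simp)
    refine Nat.card_quot_eq F ((hrel ℕ F).2 ⟨.of_factor id (fun k hk => (hF1 k hk).1)
      (fun k hk => (hF1 k hk).2), .of_const (by omega) 0 i (fun k hk => (hF2 k hk).1)
      (fun k hk => (hF2 k hk).2)⟩) (fun a => ?_) (fun x hx => ?_) φ fun a => ?_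
    · simp only [circleExponent, i0.ne', j0, if_true, if_false]
      rcases cover a with ⟨k, hk, rfl | rfl⟩ | ⟨k, hk, rfl | rfl⟩
      · rw [(hF1 k hk).1]; have := mono hk; omega
      · rw [(hF1 k hk).2]; have := mono hk; omega
      · rw [(hF2 k hk).1]; omega
      · rw [(hF2 k hk).2]; omega
    · simp only [circleExponent, i0.ne', j0, if_true, if_false] at hx
      obtain ⟨k, hk, e⟩ := Nat.exists_count_eq (s · = true) (Nat.lt_succ_iff.1 hx)
      exact ⟨L k, (hF1 k hk).1.trans e⟩
    · have g0 := (hφ 0 (Nat.zero_le _)).1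
      have gm := (hφ m le_rfl).1
      rw [z] at g0
      rcases cover a with ⟨k, hk, rfl | rfl⟩ | ⟨k, hk, rfl | rfl⟩
      · rw [(hF1 k hk).1, (hφ k hk).1]
      · rw [(hF1 k hk).2, (hφ k hk).2]
      · rw [(hF2 k hk).1, (k2 k hk).1, e1, g0]
      · rw [(hF2 k hk).2, (k2 k hk).2, e2, gm]
  · obtain ⟨φ, hφ⟩ := c1.exists_factor i0
    obtain ⟨ψ, hψ⟩ := c2.exists_factor j0
    -- The cap and cup of both columns form one outer circle, numbered `0`. The inner circles of the
    -- first column get `1, ..., i - 1`, those of the second `i, ..., i + j - 2`.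
    let f : ℕ → ℕ := fun x => if x = i then 0 else x
    let g : ℕ → ℕ := fun x => if x = 0 ∨ x = j then 0 else x + i - 1
    have hf0 : f 0 = 0 := by simp [f]
    have hfi : f i = 0 := by simp [f]
    have hg0 : g 0 = 0 := by simp [g]
    have hgj : g j = 0 := by simp [g]
    obtain ⟨F, hF1, hF2⟩ := lift (fun k => f (Nat.count (s · = true) k))
      (fun k => f (Nat.count (s · = true) k)) (fun k => g (Nat.count (s' · = true) k))
      (fun k => g (Nat.count (s' · = true) k)) (by simp only [z, z', hf0, hg0])
      (by simp only [z', ← hi, hg0, hfi]) (by simp only [← hi, ← hj, hfi, hgj])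
      (by simp only [z, ← hj, hf0, hgj])
    have hN : circleExponent i j + 1 = i + j - 1 := by
      simp only [circleExponent, i0.ne', j0.ne', if_false]; omega
    rw [hN]
    have g0 := (hφ 0 (Nat.zero_le _)).1
    have g0' := (hφ 0 (Nat.zero_le _)).2
    have gm := (hφ m le_rfl).1
    have k0 := (hψ 0 (Nat.zero_le _)).1
    have k0' := (hψ 0 (Nat.zero_le _)).2
    have kn := (hψ n le_rfl).1
    rw [z] at g0 g0'
    rw [z'] at k0 k0'
    have hφi : φ i = φ 0 := by rw [← gm, ← e2, k0', ← k0, e1, g0]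
    have hψ0 : ψ 0 = φ 0 := by rw [← k0, e1, g0]
    have hψj : ψ j = φ 0 := by rw [← kn, e4, g0']
    have hGf : ∀ x ≤ i, (if f x < i then φ (f x) else ψ (f x + 1 - i)) = φ x := by
      intro x hx
      by_cases h : x = i
      · subst h; rw [hfi, if_pos i0, hφi]
      · simp only [f, if_neg h]; rw [if_pos (by omega)]
    have hGg : ∀ x ≤ j, (if g x < i then φ (g x) else ψ (g x + 1 - i)) = ψ x := by
      intro x hx
      by_cases h : x = 0 ∨ x = j
      · have hx0 : ψ x = φ 0 := by rcases h with rfl | rfl <;> assumption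
        simp only [g, if_pos h, i0, if_true, hx0]
      · simp only [g, if_neg h]; rw [if_neg (by omega)]; congr 1; omega
    have hflt : ∀ x ≤ i, f x < i + j - 1 := by
      intro x hx; simp only [f]; split_ifs <;> omega
    have hglt : ∀ x ≤ j, g x < i + j - 1 := by
      intro x hx; simp only [g]; split_ifs <;> omega
    refine Nat.card_quot_eq F ((hrel ℕ F).2 ⟨.of_factor f (fun k hk => (hF1 k hk).1)
      (fun k hk => (hF1 k hk).2), .of_factor g (fun k hk => (hF2 k hk).1)
      (fun k hk => (hF2 k hk).2)⟩) (fun a => ?_) (fun x hx => ?_)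
      (fun x => if x < i then φ x else ψ (x + 1 - i)) fun a => ?_
    · rcases cover a with ⟨k, hk, rfl | rfl⟩ | ⟨k, hk, rfl | rfl⟩
      · rw [(hF1 k hk).1]; exact hflt _ (mono hk)
      · rw [(hF1 k hk).2]; exact hflt _ (mono hk)
      · rw [(hF2 k hk).1]; exact hglt _ (mono' hk)
      · rw [(hF2 k hk).2]; exact hglt _ (mono' hk)
    · by_cases hxi : x < i
      · obtain ⟨k, hk, e⟩ := Nat.exists_count_eq (s · = true) hxi.le
        refine ⟨L k, (hF1 k hk).1.trans ?_⟩
        simp only [e, f, if_neg hxi.ne]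
      · obtain ⟨k, hk, e⟩ := Nat.exists_count_eq (s' · = true)
          (show x + 1 - i ≤ Nat.count (s' · = true) n by omega)
        refine ⟨L' k, (hF2 k hk).1.trans ?_⟩
        simp only [e, g]
        rw [if_neg (by omega)]
        omega
    · rcases cover a with ⟨k, hk, rfl | rfl⟩ | ⟨k, hk, rfl | rfl⟩
      · simp only [(hF1 k hk).1, (hφ k hk).1]; exact hGf _ (mono hk)
      · simp only [(hF1 k hk).2, (hφ k hk).2]; exact hGf _ (mono hk)
      · simp only [(hF2 k hk).1, (hψ k hk).1]; exact hGg _ (mono' hk)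
      · simp only [(hF2 k hk).2, (hψ k hk).2]; exact hGg _ (mono' hk)

/-! ### The arcs and smoothings of the double twist diagram -/

namespace LinkDiagram

theorem numArcs_of_pos {m n : ℕ} (hm : 0 < m) : numArcs m n = 2 * (m + n) := by
  unfold numArcs; omega

theorem natCast_eq_strand_right {m n k : ℕ} (hk : k ≤ 2 * m + n) :
    (2 * m + n - k : ZMod (numArcs m n)) = ((2 * m + n - k : ℕ) : ZMod (numArcs m n)) := by
  rw [Nat.cast_sub hk]; push_cast; ring

theorem natCast_eq_strand_left' {m n k : ℕ} (hk : k ≤ 2 * m + 2 * n) :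
    (2 * m + 2 * n - k : ZMod (numArcs m n)) =
      ((2 * m + 2 * n - k : ℕ) : ZMod (numArcs m n)) := by
  rw [Nat.cast_sub hk]; push_cast; ring

theorem two_mul_add_two_mul_eq_zero {m n : ℕ} (hm : 0 < m) :
    (2 * m + 2 * n : ZMod (numArcs m n)) = 0 := by
  have := ZMod.natCast_self (numArcs m n)
  rw [numArcs_of_pos hm] at this ⊢
  push_cast at this
  rw [← this]; ring

/-- Every arc of the double twist diagram lies on a strand of one of the two columns. -/
theorem exists_level {m n : ℕ} (hm : 0 < m) (a : ZMod (numArcs m n)) :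
    (∃ k ≤ m, a = (k : ℕ) ∨ a = 2 * m + n - (k : ℕ)) ∨
      (∃ k ≤ n, a = 2 * m + 2 * n - (k : ℕ) ∨ a = m + (k : ℕ)) := by
  have hlt := a.val_lt
  have ha := (ZMod.natCast_zmod_val a).symm
  generalize a.val = v at hlt ha
  subst ha
  rw [numArcs_of_pos hm] at hlt
  by_cases h1 : v ≤ m
  · exact .inl ⟨v, h1, .inl rfl⟩
  by_cases h2 : v ≤ m + n
  · exact .inr ⟨v - m, by omega, .inr (by rw [Nat.cast_sub (by omega)]; ring)⟩
  by_cases h3 : v ≤ 2 * m + n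
  · exact .inl ⟨2 * m + n - v, by omega, .inr (by rw [Nat.cast_sub h3]; push_cast; ring)⟩
  · exact .inr ⟨2 * m + 2 * n - v, by omega,
      .inl (by rw [Nat.cast_sub (by omega)]; push_cast; ring)⟩

/-- Labels of the strands of the two columns that agree where the columns are glued come from labels
of the arcs of the double twist diagram. -/
theorem exists_labelling {m n : ℕ} (hm : 0 < m) (hn : 0 < n) {Y : Type*} (l r l' r' : ℕ → Y)
    (h1 : l' 0 = l 0) (h2 : r' 0 = l m) (h3 : r' n = r m) (h4 : l' n = r 0) :
    ∃ F : ZMod (numArcs m n) → Y,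
      (∀ k ≤ m, F (k : ℕ) = l k ∧ F (2 * m + n - (k : ℕ)) = r k) ∧
      (∀ k ≤ n, F (2 * m + 2 * n - (k : ℕ)) = l' k ∧ F (m + (k : ℕ)) = r' k) := by
  have hv : ∀ v < 2 * (m + n), ((v : ℕ) : ZMod (numArcs m n)).val = v := fun v hv => by
    rw [ZMod.val_natCast, numArcs_of_pos hm, Nat.mod_eq_of_lt hv]
  -- The cyclic chain of arcs is cut into the stretches `L`, `R'`, `R`, `L'`; the gluing hypotheses
  -- are used where they meet.
  refine ⟨fun a => if a.val ≤ m then l a.val else if a.val ≤ m + n then r' (a.val - m) else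
    if a.val ≤ 2 * m + n then r (2 * m + n - a.val) else l' (2 * m + 2 * n - a.val),
    fun k hk => ⟨?_, ?_⟩, fun k hk => ⟨?_, ?_⟩⟩
  · simp only [hv k (by omega), hk, if_true]
  · simp only [natCast_eq_strand_right (show k ≤ 2 * m + n by omega),
      hv _ (show 2 * m + n - k < 2 * (m + n) by omega)]
    rw [if_neg (by omega)]
    rcases hk.eq_or_lt with rfl | hk
    · rw [if_pos (by omega), ← h3]; congr 1; omega
    · rw [if_neg (by omega), if_pos (by omega)]; congr 1; omega
  -- At `k = 0` the arc `2m + 2n` wraps around to arc `0`.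
  · rcases k.eq_zero_or_pos with rfl | hk0
    · rw [Nat.cast_zero, sub_zero, two_mul_add_two_mul_eq_zero hm]
      simp [h1]
    simp only [natCast_eq_strand_left' (show k ≤ 2 * m + 2 * n by omega),
      hv _ (show 2 * m + 2 * n - k < 2 * (m + n) by omega)]
    rw [if_neg (by omega), if_neg (by omega)]
    rcases hk.eq_or_lt with rfl | hk
    · rw [if_pos (by omega), h4]; congr 1; omega
    · rw [if_neg (by omega)]; congr 1; omega
  · rw [← Nat.cast_add]
    simp only [hv _ (show m + k < 2 * (m + n) by omega)]
    rcases k.eq_zero_or_pos with rfl | hk0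
    · rw [if_pos (by omega), h2]; congr 1
    · rw [if_neg (by omega), if_pos (by omega)]; congr 1; omega

/-- The state of a column, as a function of all natural numbers. -/
def extendState {m : ℕ} (s : Fin m → Bool) (k : ℕ) : Bool := if h : k < m then s ⟨k, h⟩ else false

theorem extendState_val {m : ℕ} (s : Fin m → Bool) (c : Fin m) : extendState s c = s c := by
  simp [extendState]

theorem count_extendState {m : ℕ} (s : Fin m → Bool) :
    Nat.count (extendState s · = true) m = ∑ c, if s c = true then 1 else 0 := by
  rw [Nat.count_eq_card_filter_range, Finset.card_filter,
    ← Fin.sum_univ_eq_sum_range (fun k => if extendState s k = true then 1 else 0)]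
  simp only [extendState_val]

/-- The sign of the twists enters here: for a positive half twist ends `0, 3` are the two lower ones
and `1, 2` the two upper ones, so `true` is the horizontal smoothing. -/
theorem forall_joined_halfTwist {α Y : Type} {m : ℕ} (s : Fin m → Bool) (L R : ℕ → α) (F : α → Y) :
    (∀ c : Fin m, if s c = true
      then F (halfTwist true L R c 0) = F (halfTwist true L R c 3) ∧
        F (halfTwist true L R c 1) = F (halfTwist true L R c 2)
      else F (halfTwist true L R c 0) = F (halfTwist true L R c 1) ∧
        F (halfTwist true L R c 2) = F (halfTwist true L R c 3)) ↔
    IsColumnColoring m (extendState s) (fun k => F (L k)) (fun k => F (R k)) := by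
  have : ∀ c : Fin m, (if s c = true
      then F (halfTwist true L R c 0) = F (halfTwist true L R c 3) ∧
        F (halfTwist true L R c 1) = F (halfTwist true L R c 2)
      else F (halfTwist true L R c 0) = F (halfTwist true L R c 1) ∧
        F (halfTwist true L R c 2) = F (halfTwist true L R c 3)) ↔
      if extendState s c = true then F (L c) = F (R c) ∧ F (L (c + 1)) = F (R (c + 1))
      else F (L c) = F (L (c + 1)) ∧ F (R c) = F (R (c + 1)) := fun c => by
    rw [extendState_val]
    change (if s c = true then F (R (c + 1)) = F (L (c + 1)) ∧ F (R c) = F (L c)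
      else F (R (c + 1)) = F (R c) ∧ F (L c) = F (L (c + 1))) ↔ _
    split_ifs
    · exact ⟨fun h => ⟨h.2.symm, h.1.symm⟩, fun h => ⟨h.2.symm, h.1.symm⟩⟩
    · exact ⟨fun h => ⟨h.2, h.1.symm⟩, fun h => ⟨h.2.symm, h.1⟩⟩
  simp only [this]
  exact ⟨fun h k hk => h ⟨k, hk⟩, fun h c => h c c.isLt⟩

theorem forall_joined (D : LinkDiagram) (s : D.Crossing → Bool) {Y : Type} (F : D.Arc → Y) :
    (∀ a b, D.Joined s a b → F a = F b) ↔ ∀ c, if s c = true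
      then F (D.strand c 0) = F (D.strand c 3) ∧ F (D.strand c 1) = F (D.strand c 2)
      else F (D.strand c 0) = F (D.strand c 1) ∧ F (D.strand c 2) = F (D.strand c 3) := by
  constructor
  · intro h c
    split_ifs with hs
    · exact ⟨h _ _ ⟨c, by simp [hs]⟩, h _ _ ⟨c, by simp [hs]⟩⟩
    · exact ⟨h _ _ ⟨c, by simp [hs]⟩, h _ _ ⟨c, by simp [hs]⟩⟩
  · rintro h a b ⟨c, hc⟩
    have h' := h c
    split_ifs at hc h'
    · rcases hc with ⟨rfl, rfl⟩ | ⟨rfl, rfl⟩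
      exacts [h'.1, h'.2]
    · rcases hc with ⟨rfl, rfl⟩ | ⟨rfl, rfl⟩
      exacts [h'.1, h'.2]

theorem loops_doubleTwist {m n : ℕ} (hm : 0 < m) (hn : 0 < n)
    (s : (doubleTwist m n).Crossing → Bool) :
    (doubleTwist m n).loops s =
      circleExponent (∑ c : Fin m, if s (.inl c) = true then 1 else 0)
        (∑ c : Fin n, if s (.inr c) = true then 1 else 0) + 1 := by
  rw [← count_extendState (fun c : Fin m => s (.inl c)),
    ← count_extendState (fun c : Fin n => s (.inr c))]
  refine card_quot_two_columns (A := ZMod (numArcs m n))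
    (L := fun k => (k : ℕ)) (R := fun k => 2 * m + n - (k : ℕ))
    (L' := fun k => 2 * m + 2 * n - (k : ℕ)) (R' := fun k => m + (k : ℕ))
    (exists_level hm) ?_ ?_ ?_ (exists_labelling hm hn) fun Y F => ?_
  · simp [two_mul_add_two_mul_eq_zero hm]
  · simp
  · simp only [Nat.cast_zero]; ring
  · have hm' : decide (0 < (m : ℤ)) = true := by simpa using hm
    have hn' : decide (0 < (n : ℤ)) = true := by simpa using hn
    refine (forall_joined (doubleTwist m n) s F).trans ?_
    rw [← forall_joined_halfTwist, ← forall_joined_halfTwist]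
    refine Sum.forall.trans ?_
    simp only [doubleTwist, hm', hn']
    rfl

end LinkDiagram

/-! ### Evaluation of the state sum -/

theorem sum_state_prod_mul_pow {R : Type*} [CommRing R] (m : ℕ) (a b x : R) :
    ∑ s : Fin m → Bool, (∏ c, if s c = true then a else b) *
      x ^ (∑ c, if s c = true then 1 else 0) = (a * x + b) ^ m := by
  have : a * x + b = ∑ t : Bool, if t = true then a * x else b := by simp
  rw [this, Fintype.sum_pow]
  refine Finset.sum_congr rfl fun s _ => ?_
  rw [← Finset.prod_pow_eq_pow_sum, ← Finset.prod_mul_distrib]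
  refine Finset.prod_congr rfl fun c _ => ?_
  split_ifs <;> simp

/-- The factor `d ^ 2` absorbs the `- 2` in the exponent, and `0 ^ i`, `0 ^ j` serve as indicators
of uncut columns. The case distinction becomes a sum of products of a function of `i` and a function
of `j`. -/
theorem sq_mul_pow_circleExponent {R : Type*} [CommRing R] (d : R) (i j : ℕ) :
    d ^ 2 * d ^ circleExponent i j =
      d ^ i * d ^ j + (d ^ 2 - 1) * (d ^ i * 0 ^ j + 0 ^ i * d ^ j - 0 ^ i * 0 ^ j) := by
  unfold circleExponent
  split_ifs with hi hj
  · subst hi; ring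
  · subst hj; simp only [zero_pow hi]; ring
  · simp only [zero_pow hi, zero_pow hj]
    rw [← pow_add, ← pow_add, show 2 + (i + j - 2) = i + j by omega]
    ring

theorem sum_state_two_columns {R : Type*} [CommRing R] (m n : ℕ) (a b d : R) :
    d ^ 2 * ∑ s : Fin m ⊕ Fin n → Bool, (∏ c, if s c = true then a else b) *
      d ^ circleExponent (∑ c : Fin m, if s (.inl c) = true then 1 else 0)
        (∑ c : Fin n, if s (.inr c) = true then 1 else 0) =
    (a * d + b) ^ m * (a * d + b) ^ n + (d ^ 2 - 1) *
      ((a * d + b) ^ m * b ^ n + b ^ m * (a * d + b) ^ n - b ^ m * b ^ n) := by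
  -- The indicator terms thus become the case `x = 0` of `sum_state_prod_mul_pow`.
  have h0 : ∀ k, b ^ k = (a * 0 + b) ^ k := fun k => by rw [mul_zero, zero_add]
  rw [h0 m, h0 n]
  simp only [← sum_state_prod_mul_pow, Finset.sum_mul_sum]
  rw [← (Equiv.sumArrowEquivProdArrow (Fin m) (Fin n) Bool).symm.sum_comp,
    Fintype.sum_prod_type]
  simp only [← Finset.sum_add_distrib, ← Finset.sum_sub_distrib, Finset.mul_sum]
  refine Finset.sum_congr rfl fun s _ => Finset.sum_congr rfl fun t _ => ?_
  rw [Fintype.prod_sum_type]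
  change d ^ 2 * (((∏ c, if s c = true then a else b) * ∏ c, if t c = true then a else b) *
    d ^ circleExponent (∑ c, if s c = true then 1 else 0)
      (∑ c, if t c = true then 1 else 0)) = _
  rw [mul_left_comm, sq_mul_pow_circleExponent]
  ring

/-- The Kauffman bracket of the double twist diagram with columns of `m` and `n` positive half twists
is `A ^ (-m - n)` times the value of this polynomial at `-A ^ 4`. -/
noncomputable def doubleTwistPolynomial (m n : ℕ) : Polynomial ℤ :=
  Polynomial.X ^ m + Polynomial.X ^ n - 1 - Polynomial.X *
    ((∑ k ∈ Finset.range m, Polynomial.X ^ k) * ∑ k ∈ Finset.range n, Polynomial.X ^ k)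

/-- The right side is that of `sum_state_two_columns`. The division by `d²` rests on `(u - 1)² S S'
= (u^m - 1) (u^n - 1)` for the geometric sums `S`, `S'`, together with `d² u = -(u - 1)²`. -/
theorem sq_mul_aeval_doubleTwistPolynomial {R : Type*} [CommRing R] (m n : ℕ) (a b : R)
    (hab : a * b = 1) :
    (-a ^ 2 - b ^ 2) ^ 2 * (b ^ (m + n) * Polynomial.aeval (-a ^ 4) (doubleTwistPolynomial m n)) =
    (a * (-a ^ 2 - b ^ 2) + b) ^ m * (a * (-a ^ 2 - b ^ 2) + b) ^ n + ((-a ^ 2 - b ^ 2) ^ 2 - 1) *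
      ((a * (-a ^ 2 - b ^ 2) + b) ^ m * b ^ n + b ^ m * (a * (-a ^ 2 - b ^ 2) + b) ^ n -
        b ^ m * b ^ n) := by
  simp only [doubleTwistPolynomial, map_sub, map_add, map_mul, map_sum, map_pow, map_one,
    Polynomial.aeval_X]
  set u := -a ^ 4 with hu
  have e1 : a * (-a ^ 2 - b ^ 2) + b = b * u := by
    rw [hu]; linear_combination (-b + a ^ 3) * hab
  have e2 : (-a ^ 2 - b ^ 2) ^ 2 * u = -(u - 1) ^ 2 := by
    rw [hu]; linear_combination (-2 * a ^ 4 - (a * b) ^ 3 - (a * b) ^ 2 - a * b - 1 -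
      2 * a ^ 4 * (a * b)) * hab
  have gm := geom_sum_mul u m
  have gn := geom_sum_mul u n
  rw [e1, mul_pow, mul_pow, pow_add]
  set S := ∑ k ∈ Finset.range m, u ^ k
  set S' := ∑ k ∈ Finset.range n, u ^ k
  linear_combination (-(b ^ m * b ^ n * S * S')) * e2 + b ^ m * b ^ n * (S' * (u - 1)) * gm +
    b ^ m * b ^ n * (u ^ m - 1) * gn

theorem LinkDiagram.bracket_doubleTwist {m n : ℕ} (hm : 0 < m) (hn : 0 < n) :
    (doubleTwist m n).bracket = LaurentPolynomial.T (-((m + n : ℕ) : ℤ)) *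
      Polynomial.aeval (-LaurentPolynomial.T 4 : ℤ[T;T⁻¹]) (doubleTwistPolynomial m n) := by
  have hT : ∀ k : ℕ, (LaurentPolynomial.T (k : ℤ) : ℤ[T;T⁻¹]) = LaurentPolynomial.T 1 ^ k := by
    intro k; rw [LaurentPolynomial.T_pow, mul_one]
  have hT' : ∀ k : ℕ,
      (LaurentPolynomial.T (-(k : ℤ)) : ℤ[T;T⁻¹]) = LaurentPolynomial.T (-1) ^ k := by
    intro k; rw [LaurentPolynomial.T_pow]; congr 1; ring
  have hab : (LaurentPolynomial.T 1 * LaurentPolynomial.T (-1) : ℤ[T;T⁻¹]) = 1 := by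
    rw [← LaurentPolynomial.T_add]; simp
  have h2 := hT 2
  have h2' := hT' 2
  have h4 := hT 4
  push_cast at h2 h2' h4
  -- The coefficient at degree `2` is `-1`, so `d` is nonzero and `d²` may be cancelled.
  have hd : (-LaurentPolynomial.T 2 - LaurentPolynomial.T (-2) : ℤ[T;T⁻¹]) ≠ 0 := fun h => by
    have := congrArg (fun f : ℤ[T;T⁻¹] => f.coeff 2) h
    simp at this
  refine mul_left_cancel₀ (pow_ne_zero 2 hd) ?_
  unfold bracket
  simp only [loops_doubleTwist hm hn, Nat.add_sub_cancel]
  refine (sum_state_two_columns m n _ _ _).trans ?_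
  rw [hT', h2, h2', h4]
  exact (sq_mul_aeval_doubleTwistPolynomial m n _ _ hab).symm

/-! ### Extreme coefficients -/

theorem Polynomial.natDegree_geom_sum_X (m : ℕ) :
    (∑ k ∈ Finset.range (m + 1), (X : Polynomial ℤ) ^ k).natDegree = m := by
  have h := congrArg natDegree (geom_sum_mul (X : Polynomial ℤ) (m + 1))
  rw [← C_1, natDegree_X_pow_sub_C, (monic_geom_sum_X (show m + 1 ≠ 0 by omega)).natDegree_mul
    (monic_X_sub_C 1), natDegree_X_sub_C] at h
  exact Nat.succ_injective h

theorem coeff_zero_doubleTwistPolynomial {m n : ℕ} (hm : 0 < m) (hn : 0 < n) :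
    (doubleTwistPolynomial m n).coeff 0 = -1 := by
  simp [doubleTwistPolynomial, Polynomial.coeff_X_pow, hm.ne, hn.ne]

/-- The subtracted product is monic of degree `1 + (m - 1) + (n - 1)`, which exceeds both `m` and
`n` exactly when `m, n > 1`. -/
theorem natDegree_doubleTwistPolynomial_lt_and_coeff {m n : ℕ} (hm : 1 < m) (hn : 1 < n) :
    (doubleTwistPolynomial m n).natDegree < m + n ∧
      (doubleTwistPolynomial m n).coeff (m + n - 1) = -1 := by
  -- From here `m` and `n` are the original values minus `2`, so the top degree reads `m + n + 3`.
  obtain ⟨m, rfl⟩ := Nat.exists_eq_add_of_lt hm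
  obtain ⟨n, rfl⟩ := Nat.exists_eq_add_of_lt hn
  have hM := (Polynomial.monic_X (R := ℤ)).mul
    ((Polynomial.monic_geom_sum_X (R := ℤ) (Nat.succ_ne_zero (1 + m))).mul
      (Polynomial.monic_geom_sum_X (Nat.succ_ne_zero (1 + n))))
  have hdeg : (Polynomial.X * ((∑ k ∈ Finset.range (1 + m + 1), (Polynomial.X : Polynomial ℤ) ^ k) *
      ∑ k ∈ Finset.range (1 + n + 1), Polynomial.X ^ k)).natDegree = m + n + 3 := by
    rw [Polynomial.monic_X.natDegree_mul ((Polynomial.monic_geom_sum_X (Nat.succ_ne_zero _)).mul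
      (Polynomial.monic_geom_sum_X (Nat.succ_ne_zero _))),
      (Polynomial.monic_geom_sum_X (Nat.succ_ne_zero _)).natDegree_mul
      (Polynomial.monic_geom_sum_X (Nat.succ_ne_zero _)), Polynomial.natDegree_geom_sum_X,
      Polynomial.natDegree_geom_sum_X, Polynomial.natDegree_X]
    ring
  have hc := hM.coeff_natDegree
  simp only [Nat.succ_eq_add_one] at hc
  rw [hdeg] at hc
  constructor
  · refine lt_of_le_of_lt (?_ : _ ≤ m + n + 3) (by omega)
    refine (Polynomial.natDegree_sub_le _ _).trans (max_le ?_ hdeg.le)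
    refine (Polynomial.natDegree_sub_le _ _).trans (max_le ?_ (by simp))
    refine (Polynomial.natDegree_add_le _ _).trans (max_le ?_ ?_) <;>
      rw [Polynomial.natDegree_X_pow] <;> omega
  · rw [show 1 + m + 1 + (1 + n + 1) - 1 = m + n + 3 by omega, doubleTwistPolynomial,
      Polynomial.coeff_sub, hc]
    simp only [Polynomial.coeff_sub, Polynomial.coeff_add, Polynomial.coeff_X_pow,
      Polynomial.coeff_one]
    rw [if_neg (by omega), if_neg (by omega), if_neg (by omega)]
    norm_num

/-- Coefficients of `A ^ z` times the value of an integer polynomial at `-A ^ 4`. -/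
theorem coeff_T_mul_aeval_neg_T_four (z : ℤ) (P : Polynomial ℤ) (x : ℤ) :
    (LaurentPolynomial.T z * Polynomial.aeval (-LaurentPolynomial.T 4 : ℤ[T;T⁻¹]) P).coeff x =
      ∑ k ∈ Finset.range (P.natDegree + 1), if z + 4 * k = x then (-1) ^ k * P.coeff k else 0 := by
  rw [Polynomial.aeval_eq_sum_range, Finset.mul_sum, AddMonoidAlgebra.coeff_sum,
    Finsupp.finsetSum_apply]
  refine Finset.sum_congr rfl fun k _ => ?_
  have : (LaurentPolynomial.T z * (P.coeff k • (-LaurentPolynomial.T 4) ^ k) : ℤ[T;T⁻¹]) =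
      (((-1) ^ k * P.coeff k : ℤ)) • LaurentPolynomial.T (z + 4 * k) := by
    rw [neg_pow, LaurentPolynomial.T_pow, LaurentPolynomial.T_add, mul_comm (k : ℤ) 4]
    simp only [zsmul_eq_mul]
    push_cast
    ring
  rw [this, AddMonoidAlgebra.coeff_smul, Finsupp.smul_apply, LaurentPolynomial.T_apply]
  simp

/-- The exponents `z + 4 k` are distinct, so no coefficients of `P` cancel. -/
theorem isLowestTerm_isHighestTerm_T_mul_aeval {z : ℤ} {P : Polynomial ℤ} {N : ℕ}
    (hdeg : P.natDegree ≤ N) (h0 : P.coeff 0 ≠ 0) (hN : P.coeff N ≠ 0) :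
    IsLowestTerm (LaurentPolynomial.T z *
      Polynomial.aeval (-LaurentPolynomial.T 4 : ℤ[T;T⁻¹]) P) z (P.coeff 0) ∧
    IsHighestTerm (LaurentPolynomial.T z *
      Polynomial.aeval (-LaurentPolynomial.T 4 : ℤ[T;T⁻¹]) P) (z + 4 * N)
        ((-1) ^ N * P.coeff N) := by
  obtain rfl : P.natDegree = N := le_antisymm hdeg (Polynomial.le_natDegree_of_ne_zero hN)
  have hcoeff : ∀ k ≤ P.natDegree, (LaurentPolynomial.T z *
      Polynomial.aeval (-LaurentPolynomial.T 4 : ℤ[T;T⁻¹]) P).coeff (z + 4 * k) =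
      (-1) ^ k * P.coeff k := by
    intro k hk
    rw [coeff_T_mul_aeval_neg_T_four, Finset.sum_eq_single k]
    · simp
    · intro j _ hj
      rw [if_neg (by omega)]
    · intro h; simp at h; omega
  have hsupp : ∀ x, (LaurentPolynomial.T z *
      Polynomial.aeval (-LaurentPolynomial.T 4 : ℤ[T;T⁻¹]) P).coeff x ≠ 0 →
      z ≤ x ∧ x ≤ z + 4 * P.natDegree := by
    intro x hx
    rw [coeff_T_mul_aeval_neg_T_four] at hx
    obtain ⟨k, hk, h⟩ := Finset.exists_ne_zero_of_sum_ne_zero hx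
    have : z + 4 * k = x := by by_contra h'; exact h (if_neg h')
    have := Finset.mem_range.1 hk
    omega
  have hz := hcoeff 0 (Nat.zero_le _)
  have hz' := hcoeff P.natDegree le_rfl
  simp only [Nat.cast_zero, mul_zero, add_zero, pow_zero, one_mul] at hz
  refine ⟨⟨⟨?_, fun x hx => (hsupp x hx).1⟩, hz⟩, ⟨⟨?_, fun x hx => (hsupp x hx).2⟩, hz'⟩⟩
  · exact hz.trans_ne h0
  · exact hz'.trans_ne (mul_ne_zero (by simp) hN)

/-! ### Passage to the Jones polynomial -/

theorem LinkDiagram.coeff_normalizedBracket_ne_zero (D : LinkDiagram) (o : D.Orientation) (x : ℤ) :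
    (D.normalizedBracket o).coeff x ≠ 0 ↔ D.bracket.coeff (x - 3 * o.writhe) ≠ 0 := by
  have h : D.normalizedBracket o =
      AddMonoidAlgebra.single (3 * o.writhe) (o.writhe.negOnePow : ℤ) * D.bracket := by
    rw [normalizedBracket, LaurentPolynomial.single_eq_C_mul_T]
  have h' := D.bracket.coeff_single_mul_add (o.writhe.negOnePow : ℤ) (3 * o.writhe)
    (x - 3 * o.writhe)
  rw [add_sub_cancel] at h'
  rw [h, h']
  simp

/-- The exponents of the Jones polynomial are the image of those of the bracket under the increasing
map `n ↦ (n + 3 w) / 4`; the writhe `w` drops out of the difference. -/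
theorem LinkDiagram.hasSpan_jones (D : LinkDiagram) (o : D.Orientation) {a b c c' : ℤ}
    (ha : IsLowestTerm D.bracket a c) (hb : IsHighestTerm D.bracket b c') :
    HasSpan (D.jones o) (((b : ℚ) - a) / 4 + 1) := by
  have hinj : Function.Injective fun n : ℤ => (n : ℚ) / 4 := fun x y h => by
    have h' : (x : ℚ) / 4 = y / 4 := h
    have : (x : ℚ) = y := by linarith
    exact_mod_cast this
  have hset : {m | (D.jones o).coeff m ≠ 0} =
      (fun n : ℤ => ((n + 3 * o.writhe : ℤ) : ℚ) / 4) '' {m | D.bracket.coeff m ≠ 0} := by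
    ext x
    constructor
    · intro hx
      obtain ⟨y, rfl⟩ := Finsupp.mem_range_of_mapDomain_ne_zero hx
      refine ⟨y - 3 * o.writhe, (D.coeff_normalizedBracket_ne_zero o y).1 ?_, by simp⟩
      rwa [← Finsupp.mapDomain_apply hinj]
    · rintro ⟨y, hy, rfl⟩
      change (Finsupp.mapDomain _ _) _ ≠ 0
      rw [Finsupp.mapDomain_apply hinj, D.coeff_normalizedBracket_ne_zero o]
      simpa using hy
  have hmono : Monotone fun n : ℤ => ((n + 3 * o.writhe : ℤ) : ℚ) / 4 := fun x y h => by
    have : ((x + 3 * o.writhe : ℤ) : ℚ) ≤ ((y + 3 * o.writhe : ℤ) : ℚ) := by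
      exact_mod_cast (by omega)
    change (_ : ℚ) / 4 ≤ _ / 4
    linarith
  refine ⟨_, _, hset ▸ hmono.map_isLeast ha.1, hset ▸ hmono.map_isGreatest hb.1, ?_⟩
  push_cast
  ring

theorem lemma3p9 (p q : ℤ) (hp : 1 < p) (hq : 1 < q) :
    IsLowestTerm (LinkDiagram.doubleTwist p q).bracket (-p - q) (-1) ∧
    IsHighestTerm (LinkDiagram.doubleTwist p q).bracket (3 * (p + q) - 4)
      ((p + q).negOnePow : ℤ) ∧
    ∀ o : (LinkDiagram.doubleTwist p q).Orientation,
      HasSpan ((LinkDiagram.doubleTwist p q).jones o) ((p : ℚ) + q) := by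
  obtain ⟨m, rfl⟩ := Int.eq_ofNat_of_zero_le (by omega : 0 ≤ p)
  obtain ⟨n, rfl⟩ := Int.eq_ofNat_of_zero_le (by omega : 0 ≤ q)
  have hm : 1 < m := by omega
  have hn : 1 < n := by omega
  have h0 := coeff_zero_doubleTwistPolynomial (zero_lt_one.trans hm) (zero_lt_one.trans hn)
  obtain ⟨hdeg, hN⟩ := natDegree_doubleTwistPolynomial_lt_and_coeff hm hn
  obtain ⟨hl, hh⟩ := isLowestTerm_isHighestTerm_T_mul_aeval (z := -((m + n : ℕ) : ℤ))
    (Nat.le_sub_one_of_lt hdeg) (by rw [h0]; decide) (by rw [hN]; decide)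
  rw [← LinkDiagram.bracket_doubleTwist (zero_lt_one.trans hm) (zero_lt_one.trans hn)] at hl hh
  rw [h0, show -((m + n : ℕ) : ℤ) = -m - n by push_cast; ring] at hl
  -- The leading coefficient `-1` supplies the sign missing from `(-1) ^ (m + n - 1)`.
  have hsign : (-1 : ℤ) ^ (m + n - 1) * -1 = (((m : ℤ) + n).negOnePow : ℤ) := by
    rw [← pow_succ, show m + n - 1 + 1 = m + n by omega, ← Nat.cast_add,
      Int.coe_negOnePow_natCast]
  rw [hN, hsign, show -((m + n : ℕ) : ℤ) + 4 * ((m + n - 1 : ℕ) : ℤ) = 3 * (m + n) - 4 by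
    omega] at hh
  refine ⟨hl, hh, fun o => ?_⟩
  have h := LinkDiagram.hasSpan_jones _ o hl hh
  convert h using 1
  push_cast
  ring
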